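/- Let $n\ge 0$. A weak composition of length $n$ is a sequence $\gamma=(\gamma_1,\dots,\gamma_n)$ of nonnegative integers, and $x^\gamma=x_1^{\gamma_1}\cdots x_n^{\gamma_n}$. Let $\tilde s_i$ ($1\le i<n$) be the linear operator on $\mathbb{C}[x_1,\dots,x_n]$ that sends a monomial $x^\gamma$ to the monomial with $\gamma_i$ and $\gamma_{i+1}$ exchanged if $\gamma_i=0$ or $\gamma_{i+1}=0$, and fixes $x^\gamma$ otherwise. Put $$\tilde\partial_i f=\frac{f-\tilde s_i f}{x_i-x_{i+1}},\qquad \tilde\theta_i f=x_{i+1}\,\tilde\partial_i f,$$ and $\tilde\theta_w=\tilde\theta_{i_1}\cdots\tilde\theta_{i_m}$ for a reduced word $w=s_{i_1}\cdots s_{i_m}$ of $w\in S_n$. Let $\operatorname{flat}(\gamma)$ be obtained from $\gamma$ by moving all zeros to the right end, keeping the nonzero entries in order, and let $w_\gamma\in S_n$ be the permutation of minimal length with $w_\gamma(\gamma)=\operatorname{flat}(\gamma)$, where $S_n$ permutes positions. The fundamental Demazure atom of $\gamma$ is $$\tilde{\mathcal A}_\gamma=\tilde\theta_{w_\gamma^{-1}}\,x^{\operatorname{flat}(\gamma)}.$$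 Let $\alpha=(\alpha_1,\dots,\alpha_k)$ be a strong composition (all $\alpha_i>0$) of length $k$, let $\beta$ be a weak composition of length $n\ge k$, and let $\alpha'=(\alpha_1,\dots,\alpha_k,0,\dots,0)$ be $\alpha$ padded with zeros to length $n$. Then $\tilde{\mathcal A}_{\alpha'}\cdot\tilde{\mathcal A}_\beta$ is a positive sum of fundamental atoms: there are nonnegative integers $c_\gamma$, only finitely many of them nonzero, with $$\tilde{\mathcal A}_{\alpha'}\cdot\tilde{\mathcal A}_\beta=\sum_{\gamma}c_\gamma\,\tilde{\mathcal A}_\gamma,$$ where $\gamma$ runs over the weak compositions of length $n$. -/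

import Mathlib

open MvPolynomial

/-! Weak compositions of length `n` are functions `Fin n → ℕ` (the entry in position `i + 1` of the
usual notation is the value at `i : Fin n`). The simple transpositions of `Fin n` are indexed by
`Fin (n - 1)`: the letter `i` exchanges the positions `lo i = i` and `hi i = i + 1`. -/

namespace FundAtom

def lo {n : ℕ} (i : Fin (n - 1)) : Fin n := ⟨i.1, by omega⟩

def hi {n : ℕ} (i : Fin (n - 1)) : Fin n := ⟨i.1 + 1, by omega⟩

/-- The simple transposition `s_i` of the symmetric group on `Fin n`. -/
def simpleSwap {n : ℕ} (i : Fin (n - 1)) : Equiv.Perm (Fin n) := Equiv.swap (lo i) (hi i)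

/-! ### Words and length in the symmetric group -/

/-- The permutation `s_{i₁} ⋯ s_{i_m}` of a word `[i₁, …, i_m]`. -/
def wordProd {n : ℕ} (l : List (Fin (n - 1))) : Equiv.Perm (Fin n) := (l.map simpleSwap).prod

theorem exists_wordProd_eq {n : ℕ} (w : Equiv.Perm (Fin n)) :
    ∃ l : List (Fin (n - 1)), wordProd l = w := by
  cases n with
  | zero => exact ⟨[], Subsingleton.elim _ _⟩
  | succ m =>
    have hw : w ∈ Submonoid.closure
        (Set.range fun i : Fin m => Equiv.swap i.castSucc i.succ) := by
      rw [Equiv.Perm.mclosure_swap_castSucc_succ]; trivial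
    induction hw using Submonoid.closure_induction with
    | mem x hx =>
      obtain ⟨i, rfl⟩ := hx
      refine ⟨[i], ?_⟩
      simp only [wordProd, List.map_cons, List.map_nil, List.prod_singleton]
      rfl
    | one => exact ⟨[], rfl⟩
    | mul x y _ _ hx hy =>
      obtain ⟨l, rfl⟩ := hx
      obtain ⟨l', rfl⟩ := hy
      exact ⟨l ++ l', by simp [wordProd]⟩

/-- The Coxeter length: the least number of letters in a word for `w`. -/
noncomputable def permLength {n : ℕ} (w : Equiv.Perm (Fin n)) : ℕ :=
  sInf {m | ∃ l : List (Fin (n - 1)), wordProd l = w ∧ l.length = m}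

/-- `l` is a reduced word of `w`. -/
def IsReducedWord {n : ℕ} (w : Equiv.Perm (Fin n)) (l : List (Fin (n - 1))) : Prop :=
  wordProd l = w ∧ l.length = permLength w

theorem exists_isReducedWord {n : ℕ} (w : Equiv.Perm (Fin n)) :
    ∃ l : List (Fin (n - 1)), IsReducedWord w l := by
  obtain ⟨l, hl⟩ := exists_wordProd_eq w
  exact Nat.sInf_mem (s := {m | ∃ l : List (Fin (n - 1)), wordProd l = w ∧ l.length = m})
    ⟨l.length, l, hl, rfl⟩

/-- A reduced word of `w`. -/
noncomputable def reducedWord {n : ℕ} (w : Equiv.Perm (Fin n)) : List (Fin (n - 1)) :=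
  (exists_isReducedWord w).choose

theorem reducedWord_spec {n : ℕ} (w : Equiv.Perm (Fin n)) : IsReducedWord w (reducedWord w) :=
  (exists_isReducedWord w).choose_spec

/-! ### Weak compositions, `flat`, and the shortest flattening permutation -/

/-- The (left) action of permutations on weak compositions by permuting positions:
`s_i` exchanges the entries in positions `lo i` and `hi i`. -/
def permute {n : ℕ} (w : Equiv.Perm (Fin n)) (α : Fin n → ℕ) : Fin n → ℕ :=
  fun i => α (w⁻¹ i)

/-- The list of nonzero entries of `α`, from left to right. -/
def nonzeroEntries {n : ℕ} (α : Fin n → ℕ) : List ℕ := (List.ofFn α).filter (fun a => a ≠ 0)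

/-- `flat α`: all zeros of `α` are moved to the right end, the nonzero entries keep their order. -/
def flat {n : ℕ} (α : Fin n → ℕ) : Fin n → ℕ := fun i => (nonzeroEntries α).getD i 0

theorem ofFn_flat_perm {n : ℕ} (α : Fin n → ℕ) :
    (List.ofFn (flat α)).Perm (List.ofFn α) := by
  have hlen : (List.ofFn α).length = n := by simp
  have hp := List.filter_append_perm (fun a : ℕ => decide (a ≠ 0)) (List.ofFn α)
  have hz : (List.ofFn α).filter (fun a => !decide (a ≠ 0))
      = List.replicate ((List.ofFn α).filter (fun a => !decide (a ≠ 0))).length 0 := by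
    rw [List.eq_replicate_iff]
    refine ⟨rfl, fun b hb => ?_⟩
    have := (List.mem_filter.1 hb).2
    simpa using this
  have hl := hp.length_eq
  rw [List.length_append, hlen] at hl
  refine List.Perm.trans (List.Perm.of_eq ?_) hp
  apply List.ext_getElem
  · simp only [List.length_append, List.length_ofFn]; exact hl.symm
  · intro i h1 h2
    rw [List.getElem_ofFn, List.getElem_append]
    simp only [flat, nonzeroEntries]
    split_ifs with h
    · rw [List.getD_eq_getElem _ _ h]
    · rw [List.getD_eq_default _ _ (not_lt.1 h)]
      have : ∀ x ∈ (List.ofFn α).filter (fun a => !decide (a ≠ 0)), x = 0 := by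
        intro x hx; simpa using (List.mem_filter.1 hx).2
      exact (this _ (List.getElem_mem _)).symm

theorem exists_permute_eq_flat {n : ℕ} (α : Fin n → ℕ) :
    ∃ w : Equiv.Perm (Fin n), permute w α = flat α := by
  have key : List.ofFn (flat α ∘ Tuple.sort (flat α)) = List.ofFn (α ∘ Tuple.sort α) := by
    apply List.Perm.eq_of_pairwise' (r := (· ≤ ·))
    · exact List.pairwise_ofFn.2 fun i j h => Tuple.monotone_sort (flat α) h.le
    · exact List.pairwise_ofFn.2 fun i j h => Tuple.monotone_sort α h.le
    · exact ((Equiv.Perm.ofFn_comp_perm _ _).trans (ofFn_flat_perm α)).trans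
        (Equiv.Perm.ofFn_comp_perm _ _).symm
  have key' := List.ofFn_injective key
  refine ⟨(Tuple.sort α * (Tuple.sort (flat α))⁻¹)⁻¹, ?_⟩
  funext i
  have := congrFun key' ((Tuple.sort (flat α))⁻¹ i)
  have hs : (Tuple.sort (flat α)) ((Tuple.sort (flat α))⁻¹ i) = i := Equiv.apply_symm_apply _ i
  simp only [Function.comp_apply, hs] at this
  rw [this, permute, inv_inv, Equiv.Perm.mul_apply]

theorem exists_shortest_flattening {n : ℕ} (α : Fin n → ℕ) :
    ∃ w : Equiv.Perm (Fin n), permute w α = flat α ∧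
      ∀ v : Equiv.Perm (Fin n), permute v α = flat α → permLength w ≤ permLength v := by
  obtain ⟨w, hw, hmin⟩ := Set.exists_min_image {w : Equiv.Perm (Fin n) | permute w α = flat α}
    permLength (Set.toFinite _) (exists_permute_eq_flat α)
  exact ⟨w, hw, hmin⟩

/-- `w_α`: the permutation of minimal length with `w_α(α) = flat α`. -/
noncomputable def flattenPerm {n : ℕ} (α : Fin n → ℕ) : Equiv.Perm (Fin n) :=
  (exists_shortest_flattening α).choose

theorem flattenPerm_spec {n : ℕ} (α : Fin n → ℕ) :
    permute (flattenPerm α) α = flat α ∧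
      ∀ v : Equiv.Perm (Fin n), permute v α = flat α → permLength (flattenPerm α) ≤ permLength v :=
  (exists_shortest_flattening α).choose_spec

/-! ### Hivert's quasisymmetric operators -/

/-- The quasisymmetric action of `s_i` on exponent vectors: the entries in positions `lo i` and
`hi i` are exchanged if at least one of them is zero, and nothing happens otherwise. -/
noncomputable def qSwapExp {n : ℕ} (i : Fin (n - 1)) (β : Fin n →₀ ℕ) : Fin n →₀ ℕ :=
  if β (lo i) = 0 ∨ β (hi i) = 0 then β.mapDomain (simpleSwap i) else β

/-- The quasisymmetric action of `s_i` on polynomials, extended linearly from monomials. -/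
noncomputable def qSwap {n : ℕ} (i : Fin (n - 1)) :
    MvPolynomial (Fin n) ℂ →ₗ[ℂ] MvPolynomial (Fin n) ℂ :=
  (basisMonomials (Fin n) ℂ).constr ℂ fun β => monomial (qSwapExp i β) 1

theorem qSwap_monomial {n : ℕ} (i : Fin (n - 1)) (β : Fin n →₀ ℕ) (c : ℂ) :
    qSwap i (monomial β c) = monomial (qSwapExp i β) c := by
  have h : qSwap i (monomial β (1 : ℂ)) = monomial (qSwapExp i β) 1 := by
    have := (basisMonomials (Fin n) ℂ).constr_basis ℂ
      (fun β => (monomial (qSwapExp i β) 1 : MvPolynomial (Fin n) ℂ)) β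
    rwa [coe_basisMonomials] at this
  have hc : ∀ γ : Fin n →₀ ℕ, (monomial γ c : MvPolynomial (Fin n) ℂ) = c • monomial γ 1 := by
    intro γ; rw [smul_monomial, smul_eq_mul, mul_one]
  rw [hc β, map_smul, h, ← hc]

theorem X_sub_X_dvd_sub_rename {n : ℕ} (a b : Fin n) (f : MvPolynomial (Fin n) ℂ) :
    (X a - X b : MvPolynomial (Fin n) ℂ) ∣ f - rename (Equiv.swap a b) f := by
  rw [← Ideal.mem_span_singleton, ← Ideal.Quotient.mk_eq_mk_iff_sub_mem]
  set I := Ideal.span {(X a - X b : MvPolynomial (Fin n) ℂ)}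
  have hab : Ideal.Quotient.mk I (X a) = Ideal.Quotient.mk I (X b) := by
    rw [Ideal.Quotient.mk_eq_mk_iff_sub_mem]
    exact Ideal.mem_span_singleton_self _
  have h : Ideal.Quotient.mkₐ ℂ I
      = (Ideal.Quotient.mkₐ ℂ I).comp (rename (R := ℂ) (Equiv.swap a b)) := by
    apply MvPolynomial.algHom_ext
    intro j
    simp only [AlgHom.comp_apply, rename_X, Ideal.Quotient.mkₐ_eq_mk]
    rcases eq_or_ne j a with rfl | ha
    · rw [Equiv.swap_apply_left, hab]
    · rcases eq_or_ne j b with rfl | hb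
      · rw [Equiv.swap_apply_right, hab]
      · rw [Equiv.swap_apply_of_ne_of_ne ha hb]
  exact DFunLike.congr_fun h f

theorem X_sub_X_dvd_sub_qSwap {n : ℕ} (i : Fin (n - 1)) (f : MvPolynomial (Fin n) ℂ) :
    (X (lo i) - X (hi i) : MvPolynomial (Fin n) ℂ) ∣ f - qSwap i f := by
  induction f using MvPolynomial.induction_on' with
  | monomial β c =>
    rw [qSwap_monomial, qSwapExp]
    split_ifs
    · have := X_sub_X_dvd_sub_rename (lo i) (hi i) (monomial β c)
      rwa [rename_monomial] at this
    · simp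
  | add p q hp hq =>
    rw [map_add, add_sub_add_comm]
    exact dvd_add hp hq

/-- The quasisymmetric divided difference `(f - s̃_i f) / (x_i - x_{i+1})`. -/
noncomputable def qDivDiff {n : ℕ} (i : Fin (n - 1)) (f : MvPolynomial (Fin n) ℂ) :
    MvPolynomial (Fin n) ℂ :=
  (X_sub_X_dvd_sub_qSwap i f).choose

theorem qDivDiff_spec {n : ℕ} (i : Fin (n - 1)) (f : MvPolynomial (Fin n) ℂ) :
    f - qSwap i f = (X (lo i) - X (hi i)) * qDivDiff i f :=
  (X_sub_X_dvd_sub_qSwap i f).choose_spec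

/-- The operator `θ̃_i = x_{i+1} ∂̃_i`. -/
noncomputable def qTheta {n : ℕ} (i : Fin (n - 1)) (f : MvPolynomial (Fin n) ℂ) :
    MvPolynomial (Fin n) ℂ :=
  X (hi i) * qDivDiff i f

/-- `θ̃_{i₁} ⋯ θ̃_{i_m} f` for a word `[i₁, …, i_m]`; the last letter acts first. -/
noncomputable def qThetaWord {n : ℕ} (l : List (Fin (n - 1))) (f : MvPolynomial (Fin n) ℂ) :
    MvPolynomial (Fin n) ℂ :=
  l.foldr qTheta f

/-- `θ̃_w`, computed along a reduced word of `w`. -/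
noncomputable def qThetaPerm {n : ℕ} (w : Equiv.Perm (Fin n)) (f : MvPolynomial (Fin n) ℂ) :
    MvPolynomial (Fin n) ℂ :=
  qThetaWord (reducedWord w) f

/-- The monomial `x^α`. -/
noncomputable def xPow {n : ℕ} (α : Fin n → ℕ) : MvPolynomial (Fin n) ℂ :=
  ∏ i, X i ^ α i

/-- The fundamental Demazure atom `θ̃_{w_α⁻¹} x^{flat α}`. -/
noncomputable def fundamentalAtom {n : ℕ} (α : Fin n → ℕ) : MvPolynomial (Fin n) ℂ :=
  qThetaPerm (flattenPerm α)⁻¹ (xPow (flat α))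

/-- The sequence `α` of length `k`, padded with zeros on the right to length `n` (for `k ≤ n`). -/
def padZeros {k : ℕ} (n : ℕ) (α : Fin k → ℕ) : Fin n → ℕ :=
  fun i => if h : i.1 < k then α ⟨i.1, h⟩ else 0

/-- `f` is a positive sum of fundamental atoms: a finite combination of fundamental atoms of length
`n` with nonnegative integer coefficients. -/
def IsAtomPositive {n : ℕ} (f : MvPolynomial (Fin n) ℂ) : Prop :=
  ∃ c : (Fin n → ℕ) →₀ ℕ, f = c.sum fun γ m => m • fundamentalAtom γ

end FundAtom

namespace FundAtom

/-! ### Prefix sums and the exponents of an atom -/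

/-! Every fundamental atom is a multiplicity-free sum of monomials, with exponent set
`atomExponents` (`fundamentalAtom_eq_atomSum`). If `δ` has a nonzero entry followed by a zero, the
operator at these two positions kills the monomials nonzero at both and splits the entry of each
other one in all ways with positive second part; this gives the sum for the swapped `δ`
(`qTheta_atomSum`). Each letter of a reduced word for `w_γ⁻¹` makes such a move: one letter raises
`supportWeight` by at most 1, and minimality of `w_γ` leaves no letter to waste.

The atom of the padded `α` is the single monomial `x^a`, so the product is the sum over the
translate `a + atomExponents β`. Let `D` be the first `k` positions together with the support of
`β`. Sorting the exponents by their prefix sums at `D` cuts the translate into classes, and each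
class is all of `atomExponents γ` for some `γ` with support `D` (`isAtomPositive_sum`). No class is
cut short: the prefix sums fix the first `k` entries, and `a` vanishes elsewhere. -/

/-- The sum of the first `m` entries of `f`. -/
def prefixSum {n : ℕ} (f : Fin n → ℕ) (m : ℕ) : ℕ := ∑ j : Fin n, if (j : ℕ) < m then f j else 0

@[simp] theorem prefixSum_zero {n : ℕ} (f : Fin n → ℕ) : prefixSum f 0 = 0 := by
  simp [prefixSum]

theorem prefixSum_length {n : ℕ} (f : Fin n → ℕ) : prefixSum f n = ∑ j, f j := by
  simp [prefixSum]

theorem prefixSum_succ {n : ℕ} (f : Fin n → ℕ) (p : Fin n) :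
    prefixSum f (p + 1) = prefixSum f p + f p := by
  have : f p = ∑ j : Fin n, if j = p then f j else 0 := by simp
  rw [this, prefixSum, prefixSum, ← Finset.sum_add_distrib]
  refine Finset.sum_congr rfl fun j _ => ?_
  simp only [Fin.ext_iff]
  split_ifs <;> omega

theorem prefixSum_mono {n : ℕ} (f : Fin n → ℕ) : Monotone (prefixSum f) := by
  intro a b h
  refine Finset.sum_le_sum fun j _ => ?_
  split_ifs <;> omega

theorem prefixSum_add {n : ℕ} (f g : Fin n → ℕ) (m : ℕ) :
    prefixSum (f + g) m = prefixSum f m + prefixSum g m := by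
  rw [prefixSum, prefixSum, prefixSum, ← Finset.sum_add_distrib]
  refine Finset.sum_congr rfl fun j _ => ?_
  split_ifs <;> simp

theorem eq_of_prefixSum_eq {n : ℕ} {f g : Fin n → ℕ}
    (h : ∀ m ≤ n, prefixSum f m = prefixSum g m) : f = g := by
  funext p
  have h1 := h (p + 1) p.2
  rw [prefixSum_succ, prefixSum_succ, h p p.2.le] at h1
  omega

/-- The exponents of the monomials of the atom of `δ`: in each block of positions ending at a
nonzero entry of `δ`, the entries of `ε` have that entry as their sum, the last one being nonzero,
and `ε` vanishes behind the last block. -/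
def atomExponents {n : ℕ} (δ : Fin n → ℕ) : Finset (Fin n → ℕ) :=
  (Finset.univ.piAntidiag (∑ j, δ j)).filter fun ε =>
    ∀ p : Fin n, δ p ≠ 0 → ε p ≠ 0 ∧ prefixSum ε (p + 1) = prefixSum δ (p + 1)

theorem mem_atomExponents {n : ℕ} {δ ε : Fin n → ℕ} :
    ε ∈ atomExponents δ ↔ prefixSum ε n = prefixSum δ n ∧
      ∀ p : Fin n, δ p ≠ 0 → ε p ≠ 0 ∧ prefixSum ε (p + 1) = prefixSum δ (p + 1) := by
  simp [atomExponents, prefixSum_length]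

/-- Prefix sums agree at the nonzero entries of `δ`; across its zeros those of `δ` stay constant
while those of `ε` can only grow. -/
theorem prefixSum_le_of_mem_atomExponents {n : ℕ} {δ ε : Fin n → ℕ} (h : ε ∈ atomExponents δ)
    (m : ℕ) (hm : m ≤ n) : prefixSum δ m ≤ prefixSum ε m := by
  rw [mem_atomExponents] at h
  induction m with
  | zero => simp
  | succ m ih =>
    by_cases h0 : δ ⟨m, hm⟩ = 0
    · have h1 := prefixSum_succ δ ⟨m, hm⟩
      have h2 := prefixSum_mono ε (Nat.le_succ m)
      have h3 := ih (by omega)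
      simp only [h0] at h1
      simp only [Nat.succ_eq_add_one] at h2
      omega
    · exact (h.2 _ h0).2.ge

theorem prefixSum_eq_of_zero {n : ℕ} {f : Fin n → ℕ} {m m' : ℕ} (hm : m ≤ m') (hm' : m' ≤ n)
    (h : ∀ p : Fin n, m ≤ p → f p = 0) : prefixSum f m' = prefixSum f m := by
  induction m', hm using Nat.le_induction with
  | base => rfl
  | succ j hj ih =>
    have h1 := prefixSum_succ f ⟨j, hm'⟩
    rw [h _ hj] at h1
    rw [← ih (by omega)]
    exact h1

/-- Otherwise `δ`, and hence `ε`, has reached the common total before `q`, and `ε q` would exceed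
it. -/
theorem exists_le_of_mem_atomExponents {n : ℕ} {δ ε : Fin n → ℕ} (h : ε ∈ atomExponents δ)
    {q : Fin n} (hq : ε q ≠ 0) : ∃ p, q ≤ p ∧ δ p ≠ 0 := by
  by_contra! hc
  have h1 := prefixSum_eq_of_zero (f := δ) q.2.le le_rfl hc
  have h2 := prefixSum_le_of_mem_atomExponents h q q.2.le
  have h3 := prefixSum_succ ε q
  have h4 := prefixSum_mono ε (show (q : ℕ) + 1 ≤ n from q.2)
  have h5 := (mem_atomExponents.1 h).1
  omega

/-- The zeros of `δ` are all at the right end. -/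
def IsFlat {n : ℕ} (δ : Fin n → ℕ) : Prop := ∀ p q, p ≤ q → δ p = 0 → δ q = 0

theorem atomExponents_of_isFlat {n : ℕ} {δ : Fin n → ℕ} (hδ : IsFlat δ) :
    atomExponents δ = {δ} := by
  ext ε
  rw [Finset.mem_singleton]
  constructor
  · intro h
    refine eq_of_prefixSum_eq fun m hm => ?_
    refine le_antisymm ?_ (prefixSum_le_of_mem_atomExponents h m hm)
    rw [mem_atomExponents] at h
    induction m with
    | zero => simp
    | succ m ih =>
      by_cases h0 : δ ⟨m, hm⟩ = 0
      · rw [← prefixSum_eq_of_zero hm le_rfl (f := δ), ← h.1]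
        · exact prefixSum_mono ε hm
        · intro p hp
          exact hδ ⟨m, hm⟩ p (by rw [Fin.le_def]; simp; omega) h0
      · exact (h.2 _ h0).2.le
  · rintro rfl
    exact mem_atomExponents.2 ⟨rfl, fun p hp => ⟨hp, rfl⟩⟩

/-- The sum of the monomials with exponents in `atomExponents δ`. -/
noncomputable def atomSum {n : ℕ} (δ : Fin n → ℕ) : MvPolynomial (Fin n) ℂ :=
  ∑ ε ∈ atomExponents δ, xPow ε

theorem atomSum_of_isFlat {n : ℕ} {δ : Fin n → ℕ} (hδ : IsFlat δ) : atomSum δ = xPow δ := by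
  rw [atomSum, atomExponents_of_isFlat hδ, Finset.sum_singleton]

/-! ### The operators `qTheta` on monomials -/

theorem lo_ne_hi {n : ℕ} (i : Fin (n - 1)) : lo i ≠ hi i := by simp [lo, hi]

/-- `ε` with the entries in positions `lo i` and `hi i` replaced by `a` and `b`. -/
def setPair {n : ℕ} (i : Fin (n - 1)) (ε : Fin n → ℕ) (a b : ℕ) : Fin n → ℕ :=
  Function.update (Function.update ε (lo i) a) (hi i) b

@[simp] theorem setPair_lo {n : ℕ} (i : Fin (n - 1)) (ε : Fin n → ℕ) (a b : ℕ) :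
    setPair i ε a b (lo i) = a := by
  rw [setPair, Function.update_of_ne (lo_ne_hi i), Function.update_self]

@[simp] theorem setPair_hi {n : ℕ} (i : Fin (n - 1)) (ε : Fin n → ℕ) (a b : ℕ) :
    setPair i ε a b (hi i) = b := by
  rw [setPair, Function.update_self]

theorem setPair_of_ne {n : ℕ} (i : Fin (n - 1)) (ε : Fin n → ℕ) (a b : ℕ) {p : Fin n}
    (h1 : p ≠ lo i) (h2 : p ≠ hi i) : setPair i ε a b p = ε p := by
  rw [setPair, Function.update_of_ne h2, Function.update_of_ne h1]

theorem setPair_ext {n : ℕ} {i : Fin (n - 1)} {f g : Fin n → ℕ} (h1 : f (lo i) = g (lo i))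
    (h2 : f (hi i) = g (hi i)) (h : ∀ p, p ≠ lo i → p ≠ hi i → f p = g p) : f = g := by
  funext p
  by_cases h3 : p = lo i
  · rw [h3, h1]
  by_cases h4 : p = hi i
  · rw [h4, h2]
  exact h p h3 h4

theorem setPair_setPair {n : ℕ} (i : Fin (n - 1)) (ε : Fin n → ℕ) (a b c d : ℕ) :
    setPair i (setPair i ε a b) c d = setPair i ε c d :=
  setPair_ext (i := i) (by simp) (by simp) fun p h1 h2 => by simp [setPair_of_ne, h1, h2]

theorem setPair_self {n : ℕ} (i : Fin (n - 1)) (ε : Fin n → ℕ) :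
    setPair i ε (ε (lo i)) (ε (hi i)) = ε :=
  setPair_ext (i := i) (by simp) (by simp) fun p h1 h2 => by simp [setPair_of_ne, h1, h2]

theorem permute_simpleSwap {n : ℕ} (i : Fin (n - 1)) (ε : Fin n → ℕ) :
    permute (simpleSwap i) ε = setPair i ε (ε (hi i)) (ε (lo i)) := by
  refine setPair_ext (i := i) ?_ ?_ fun p h1 h2 => ?_
  · simp [permute, simpleSwap]
  · simp [permute, simpleSwap]
  · simp [permute, simpleSwap, setPair_of_ne, h1, h2, Equiv.swap_apply_of_ne_of_ne]

theorem sum_eq_pair_add {n : ℕ} {M : Type*} [AddCommMonoid M] (i : Fin (n - 1)) (f : Fin n → M) :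
    ∑ j, f j = f (lo i) + f (hi i) + ∑ j ∈ {lo i, hi i}ᶜ, f j := by
  rw [← Finset.sum_add_sum_compl {lo i, hi i} f, Finset.sum_pair (lo_ne_hi i)]

/-- Only the prefix that ends between the two positions separates them. -/
theorem prefixSum_setPair {n : ℕ} (i : Fin (n - 1)) (ε : Fin n → ℕ) {a b m : ℕ}
    (hab : a + b = ε (lo i) + ε (hi i)) (hm : m ≠ i + 1) :
    prefixSum (setPair i ε a b) m = prefixSum ε m := by
  rw [prefixSum, prefixSum, sum_eq_pair_add i, sum_eq_pair_add i]
  congr 1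
  · simp only [setPair_lo, setPair_hi]
    have h1 : (lo i : ℕ) = i := rfl
    have h2 : (hi i : ℕ) = i + 1 := rfl
    rcases lt_or_gt_of_ne hm with h | h
    · rw [if_neg (by omega), if_neg (by omega), if_neg (by omega), if_neg (by omega)]
    · rw [if_pos (by omega), if_pos (by omega), if_pos (by omega), if_pos (by omega), hab]
  · refine Finset.sum_congr rfl fun j hj => ?_
    simp only [Finset.mem_compl, Finset.mem_insert, Finset.mem_singleton, not_or] at hj
    rw [setPair_of_ne i ε a b hj.1 hj.2]

theorem xPow_eq_monomial {n : ℕ} (ε : Fin n → ℕ) :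
    xPow ε = monomial (Finsupp.equivFunOnFinite.symm ε) 1 := by
  rw [monomial_eq, Finsupp.prod_fintype _ _ (by simp)]
  simp [xPow]

theorem xPow_add {n : ℕ} (δ ε : Fin n → ℕ) : xPow (δ + ε) = xPow δ * xPow ε := by
  simp [xPow, pow_add, Finset.prod_mul_distrib]

theorem xPow_setPair {n : ℕ} (i : Fin (n - 1)) (ε : Fin n → ℕ) (a b : ℕ) :
    xPow (setPair i ε a b) =
      X (lo i) ^ a * X (hi i) ^ b * ∏ j ∈ {lo i, hi i}ᶜ, (X j : MvPolynomial (Fin n) ℂ) ^ ε j := by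
  rw [xPow, ← Finset.prod_mul_prod_compl {lo i, hi i}, Finset.prod_pair (lo_ne_hi i)]
  simp only [setPair_lo, setPair_hi]
  congr 1
  refine Finset.prod_congr rfl fun j hj => ?_
  simp only [Finset.mem_compl, Finset.mem_insert, Finset.mem_singleton, not_or] at hj
  rw [setPair_of_ne i ε a b hj.1 hj.2]

theorem qSwap_xPow {n : ℕ} (i : Fin (n - 1)) (ε : Fin n → ℕ) :
    qSwap i (xPow ε) =
      if ε (lo i) = 0 ∨ ε (hi i) = 0 then xPow (permute (simpleSwap i) ε) else xPow ε := by
  rw [xPow_eq_monomial, qSwap_monomial, qSwapExp]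
  simp only [Finsupp.equivFunOnFinite_symm_apply_apply]
  split_ifs with h
  · rw [xPow_eq_monomial]
    refine congrArg (fun e => monomial e (1 : ℂ)) (Finsupp.ext fun p => ?_)
    rw [Finsupp.mapDomain_equiv_apply]
    rfl
  · rfl

theorem mul_qTheta {n : ℕ} (i : Fin (n - 1)) (f : MvPolynomial (Fin n) ℂ) :
    (X (lo i) - X (hi i)) * qTheta i f = X (hi i) * (f - qSwap i f) := by
  rw [qDivDiff_spec, qTheta]; ring

/-- The quotient in `qDivDiff` is obtained by choice; cancelling the nonzero factor determines it.
-/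
theorem qTheta_eq_of_mul_eq {n : ℕ} {i : Fin (n - 1)} {f g : MvPolynomial (Fin n) ℂ}
    (h : (X (lo i) - X (hi i)) * g = X (hi i) * (f - qSwap i f)) : qTheta i f = g := by
  have h0 : (X (lo i) - X (hi i) : MvPolynomial (Fin n) ℂ) ≠ 0 :=
    sub_ne_zero.2 fun h => lo_ne_hi i (X_injective h)
  exact mul_left_cancel₀ h0 ((mul_qTheta i f).trans h.symm)

theorem qTheta_sum {n : ℕ} {ι : Type*} (i : Fin (n - 1)) (s : Finset ι)
    (f : ι → MvPolynomial (Fin n) ℂ) : qTheta i (∑ j ∈ s, f j) = ∑ j ∈ s, qTheta i (f j) := by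
  apply qTheta_eq_of_mul_eq
  rw [Finset.mul_sum, map_sum, ← Finset.sum_sub_distrib, Finset.mul_sum]
  exact Finset.sum_congr rfl fun j _ => mul_qTheta i (f j)

theorem qTheta_xPow_of_ne_zero {n : ℕ} {i : Fin (n - 1)} {ε : Fin n → ℕ} (h1 : ε (lo i) ≠ 0)
    (h2 : ε (hi i) ≠ 0) : qTheta i (xPow ε) = 0 := by
  apply qTheta_eq_of_mul_eq
  rw [qSwap_xPow, if_neg (by tauto)]
  simp

/-- A geometric sum; the extra factor `X (hi i)` makes every second exponent positive, so `c` stops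
below `ε (lo i)`. -/
theorem qTheta_xPow_of_eq_zero {n : ℕ} {i : Fin (n - 1)} {ε : Fin n → ℕ} (h : ε (hi i) = 0) :
    qTheta i (xPow ε) =
      ∑ c ∈ Finset.range (ε (lo i)), xPow (setPair i ε c (ε (lo i) - c)) := by
  apply qTheta_eq_of_mul_eq
  rw [qSwap_xPow, if_pos (Or.inr h), permute_simpleSwap, h]
  have hε : xPow ε = xPow (setPair i ε (ε (lo i)) 0) := by
    conv_lhs => rw [← setPair_self i ε, h]
  rw [hε]
  simp only [xPow_setPair, pow_zero, mul_one, one_mul]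
  rw [← sub_mul, ← Finset.sum_mul, ← geom_sum₂_mul]
  have : ∑ c ∈ Finset.range (ε (lo i)),
        (X (lo i) ^ c * X (hi i) ^ (ε (lo i) - c) : MvPolynomial (Fin n) ℂ) =
      X (hi i) * ∑ c ∈ Finset.range (ε (lo i)),
        (X (lo i) ^ c * X (hi i) ^ (ε (lo i) - 1 - c) : MvPolynomial (Fin n) ℂ) := by
    rw [Finset.mul_sum]
    refine Finset.sum_congr rfl fun c hc => ?_
    rw [Finset.mem_range] at hc
    rw [show ε (lo i) - c = ε (lo i) - 1 - c + 1 by omega, pow_succ]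
    ring
  rw [this]
  ring

theorem setPair_mem_atomExponents {n : ℕ} {i : Fin (n - 1)} {δ ε : Fin n → ℕ}
    (h1 : δ (lo i) ≠ 0) (h2 : δ (hi i) = 0) (hε : ε ∈ atomExponents δ) (h0 : ε (hi i) = 0) {c : ℕ}
    (hc : c < ε (lo i)) :
    setPair i ε c (ε (lo i) - c) ∈ atomExponents (setPair i δ 0 (δ (lo i))) := by
  have hn : n ≠ i + 1 := by omega
  have hc' : c + (ε (lo i) - c) = ε (lo i) + ε (hi i) := by omega
  have hδ' : 0 + δ (lo i) = δ (lo i) + δ (hi i) := by omega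
  rw [mem_atomExponents] at hε ⊢
  refine ⟨by rw [prefixSum_setPair i ε hc' hn, prefixSum_setPair i δ hδ' hn, hε.1], fun p hp => ?_⟩
  by_cases hp1 : p = lo i
  · subst hp1; simp at hp
  have hpi : (p : ℕ) + 1 ≠ i + 1 := by
    simpa [lo, Fin.ext_iff] using hp1
  rw [prefixSum_setPair i ε hc' hpi, prefixSum_setPair i δ hδ' hpi]
  by_cases hp2 : p = hi i
  · subst hp2
    refine ⟨by rw [setPair_hi]; omega, ?_⟩
    rw [prefixSum_succ, prefixSum_succ, h0, h2]
    exact (hε.2 _ h1).2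
  · rw [setPair_of_ne i _ _ _ hp1 hp2] at hp ⊢
    exact hε.2 p hp

theorem mem_atomExponents_of_setPair {n : ℕ} {i : Fin (n - 1)} {δ ε : Fin n → ℕ}
    (h1 : δ (lo i) ≠ 0) (h2 : δ (hi i) = 0)
    (hε : ε ∈ atomExponents (setPair i δ 0 (δ (lo i)))) :
    setPair i ε (ε (lo i) + ε (hi i)) 0 ∈ atomExponents δ := by
  have hn : n ≠ i + 1 := by omega
  have hδ' : 0 + δ (lo i) = δ (lo i) + δ (hi i) := by omega
  have he : ε (lo i) + ε (hi i) + 0 = ε (lo i) + ε (hi i) := rfl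
  rw [mem_atomExponents] at hε ⊢
  refine ⟨by rw [prefixSum_setPair i ε he hn, hε.1, prefixSum_setPair i δ hδ' hn], fun p hp => ?_⟩
  by_cases hp2 : p = hi i
  · subst hp2; exact absurd h2 hp
  have hh := hε.2 (hi i) (by simpa using h1)
  by_cases hp1 : p = lo i
  · subst hp1
    refine ⟨by rw [setPair_lo]; omega, ?_⟩
    have hpi : (hi i : ℕ) + 1 ≠ i + 1 := by simp [hi]
    have h3 := prefixSum_setPair i ε he hpi
    rw [hh.2, prefixSum_setPair i δ hδ' hpi, prefixSum_succ, prefixSum_succ, h2, setPair_hi] at h3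
    exact h3
  · have hpi : (p : ℕ) + 1 ≠ i + 1 := by
      simpa [lo, Fin.ext_iff] using hp1
    have h3 := hε.2 p (by rwa [setPair_of_ne i _ _ _ hp1 hp2])
    rw [setPair_of_ne i _ _ _ hp1 hp2, prefixSum_setPair i ε he hpi]
    rwa [prefixSum_setPair i δ hδ' hpi] at h3

theorem qTheta_atomSum {n : ℕ} {i : Fin (n - 1)} {δ : Fin n → ℕ} (h1 : δ (lo i) ≠ 0)
    (h2 : δ (hi i) = 0) : qTheta i (atomSum δ) = atomSum (permute (simpleSwap i) δ) := by
  rw [permute_simpleSwap, h2, atomSum, atomSum, qTheta_sum]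
  have h3 : ∑ ε ∈ atomExponents δ, qTheta i (xPow ε) =
      ∑ ε ∈ (atomExponents δ).filter (fun ε => ε (hi i) = 0),
        ∑ c ∈ Finset.range (ε (lo i)), xPow (setPair i ε c (ε (lo i) - c)) := by
    rw [Finset.sum_filter]
    refine Finset.sum_congr rfl fun ε hε => ?_
    split_ifs with h
    · exact qTheta_xPow_of_eq_zero h
    · exact qTheta_xPow_of_ne_zero ((mem_atomExponents.1 hε).2 _ h1).1 h
  rw [h3, Finset.sum_sigma']
  -- Splitting an entry is undone by merging the pair into `lo i`; the first part is remembered as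
  -- `c`.
  refine Finset.sum_bij' (fun x _ => setPair i x.1 x.2 (x.1 (lo i) - x.2))
    (fun ε _ => ⟨setPair i ε (ε (lo i) + ε (hi i)) 0, ε (lo i)⟩) ?_ ?_ ?_ ?_ ?_
  · rintro ⟨ε, c⟩ hx
    simp only [Finset.mem_sigma, Finset.mem_filter, Finset.mem_range] at hx
    exact setPair_mem_atomExponents h1 h2 hx.1.1 hx.1.2 hx.2
  · intro ε hε
    have h4 := ((mem_atomExponents.1 hε).2 (hi i) (by simpa using h1)).1
    simp only [Finset.mem_sigma, Finset.mem_filter, Finset.mem_range, setPair_lo, setPair_hi]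
    exact ⟨⟨mem_atomExponents_of_setPair h1 h2 hε, trivial⟩, by omega⟩
  · rintro ⟨ε, c⟩ hx
    simp only [Finset.mem_sigma, Finset.mem_filter, Finset.mem_range] at hx
    simp only [setPair_lo, setPair_hi, setPair_setPair]
    rw [show c + (ε (lo i) - c) = ε (lo i) by omega]
    congr 1
    conv_rhs => rw [← setPair_self i ε, hx.1.2]
  · intro ε hε
    simp only [setPair_lo, setPair_setPair, Nat.add_sub_cancel_left, setPair_self]
  · intro x _
    rfl

/-! ### The shortest flattening permutation -/

theorem permute_mul {n : ℕ} (v w : Equiv.Perm (Fin n)) (δ : Fin n → ℕ) :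
    permute (v * w) δ = permute v (permute w δ) := by
  funext p; simp [permute]

theorem permute_one {n : ℕ} (δ : Fin n → ℕ) : permute 1 δ = δ := by
  funext p; simp [permute]

theorem wordProd_cons {n : ℕ} (i : Fin (n - 1)) (l : List (Fin (n - 1))) :
    wordProd (i :: l) = simpleSwap i * wordProd l := by
  simp [wordProd]

theorem wordProd_reverse {n : ℕ} (l : List (Fin (n - 1))) :
    wordProd l.reverse = (wordProd l)⁻¹ := by
  rw [wordProd, wordProd, List.prod_inv_reverse, List.map_map, List.map_reverse]
  congr 2

theorem permLength_le {n : ℕ} {w : Equiv.Perm (Fin n)} {l : List (Fin (n - 1))}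
    (h : wordProd l = w) : permLength w ≤ l.length :=
  Nat.sInf_le ⟨l, h, rfl⟩

theorem permLength_inv_le {n : ℕ} (w : Equiv.Perm (Fin n)) : permLength w⁻¹ ≤ permLength w := by
  obtain ⟨l, h, hl⟩ := exists_isReducedWord w
  rw [← hl, ← List.length_reverse]
  exact permLength_le (by rw [wordProd_reverse, h])

theorem permLength_mul_simpleSwap_le {n : ℕ} (w : Equiv.Perm (Fin n)) (i : Fin (n - 1)) :
    permLength (w * simpleSwap i) ≤ permLength w + 1 := by
  obtain ⟨l, h, hl⟩ := exists_isReducedWord w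
  rw [← hl]
  refine (permLength_le (l := l ++ [i]) ?_).trans (by simp)
  rw [← h]
  simp [wordProd]

/-- The sum of the positions of the nonzero entries. -/
def supportWeight {n : ℕ} (δ : Fin n → ℕ) : ℕ := ∑ p : Fin n, if δ p = 0 then 0 else (p : ℕ)

/-- A nonzero entry at `lo i` moves up by one and one at `hi i` moves down by one. -/
theorem supportWeight_swap {n : ℕ} (i : Fin (n - 1)) (δ : Fin n → ℕ) :
    supportWeight (permute (simpleSwap i) δ) + (if δ (hi i) = 0 then 0 else 1) =
      supportWeight δ + (if δ (lo i) = 0 then 0 else 1) := by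
  rw [permute_simpleSwap, supportWeight, supportWeight, sum_eq_pair_add i, sum_eq_pair_add i]
  have : ∑ p ∈ {lo i, hi i}ᶜ, (if setPair i δ (δ (hi i)) (δ (lo i)) p = 0 then 0 else (p : ℕ)) =
      ∑ p ∈ {lo i, hi i}ᶜ, if δ p = 0 then 0 else (p : ℕ) := by
    refine Finset.sum_congr rfl fun j hj => ?_
    simp only [Finset.mem_compl, Finset.mem_insert, Finset.mem_singleton, not_or] at hj
    rw [setPair_of_ne i _ _ _ hj.1 hj.2]
  rw [this, setPair_lo, setPair_hi]
  have h1 : (hi i : ℕ) = lo i + 1 := rfl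
  rw [h1]
  split_ifs <;> omega

theorem supportWeight_wordProd_le {n : ℕ} (l : List (Fin (n - 1))) (δ : Fin n → ℕ) :
    supportWeight (permute (wordProd l) δ) ≤ supportWeight δ + l.length := by
  induction l with
  | nil => simp [wordProd, permute_one]
  | cons i l ih =>
    have h := supportWeight_swap i (permute (wordProd l) δ)
    rw [wordProd_cons, permute_mul, List.length_cons]
    split_ifs at h <;> omega

/-- The hypothesis forces every letter to raise the weight by exactly 1, that is, to move a nonzero
entry right into a zero, as `qTheta_atomSum` requires. -/
theorem qThetaWord_atomSum {n : ℕ} (l : List (Fin (n - 1))) (δ : Fin n → ℕ)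
    (h : supportWeight δ + l.length ≤ supportWeight (permute (wordProd l) δ)) :
    qThetaWord l (atomSum δ) = atomSum (permute (wordProd l) δ) := by
  induction l with
  | nil => simp [wordProd, permute_one, qThetaWord]
  | cons i l ih =>
    have h1 := supportWeight_swap i (permute (wordProd l) δ)
    have h2 := supportWeight_wordProd_le l δ
    rw [wordProd_cons, permute_mul, List.length_cons] at h
    rw [wordProd_cons, permute_mul]
    have h3 : qThetaWord (i :: l) (atomSum δ) = qTheta i (qThetaWord l (atomSum δ)) := rfl
    rw [h3, ih (by split_ifs at h1 <;> omega)]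
    apply qTheta_atomSum
    · intro h0; rw [if_pos h0] at h1; omega
    · by_contra h0; rw [if_neg h0] at h1; split_ifs at h1 <;> omega

/-! ### Flattening by adjacent swaps -/

theorem isFlat_flat {n : ℕ} (δ : Fin n → ℕ) : IsFlat (flat δ) := by
  intro p q hpq hp
  have h : (nonzeroEntries δ).length ≤ p := by
    by_contra! hlt
    simp only [flat] at hp
    rw [List.getD_eq_getElem _ _ hlt] at hp
    have := List.getElem_mem hlt
    rw [hp] at this
    simp [nonzeroEntries] at this
  exact List.getD_eq_default _ _ (h.trans hpq)

theorem getD_filter_ne_zero_of_pairwise (L : List ℕ) (h : L.Pairwise fun a b => a = 0 → b = 0)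
    (m : ℕ) : (L.filter fun a => a ≠ 0).getD m 0 = L.getD m 0 := by
  induction L generalizing m with
  | nil => simp
  | cons a L ih =>
    rw [List.pairwise_cons] at h
    by_cases ha : a = 0
    · have h1 : ∀ b ∈ a :: L, b = 0 := by
        intro b hb
        rcases List.mem_cons.1 hb with rfl | hb
        · exact ha
        · exact h.1 b hb ha
      rw [List.filter_eq_nil_iff.2 (fun b hb => by simp [h1 b hb])]
      rw [List.getD_nil]
      rcases lt_or_ge m (a :: L).length with hm | hm
      · rw [List.getD_eq_getElem _ _ hm]
        exact (h1 _ (List.getElem_mem hm)).symm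
      · rw [List.getD_eq_default _ _ hm]
    · rw [List.filter_cons_of_pos (by simpa using ha)]
      cases m with
      | zero => simp
      | succ m => simpa using ih h.2 m

theorem flat_of_isFlat {n : ℕ} {δ : Fin n → ℕ} (h : IsFlat δ) : flat δ = δ := by
  funext p
  rw [flat, nonzeroEntries, getD_filter_ne_zero_of_pairwise]
  · rw [List.getD_eq_getElem _ _ (by simp), List.getElem_ofFn]
  · exact List.pairwise_ofFn.2 fun i j hij => h i j hij.le

theorem ofFn_eq_take_append_drop {n : ℕ} (i : Fin (n - 1)) (δ : Fin n → ℕ) :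
    List.ofFn δ = (List.ofFn δ).take i ++ δ (lo i) :: δ (hi i) :: (List.ofFn δ).drop (i + 2) := by
  have h1 : (i : ℕ) < (List.ofFn δ).length := by simp; omega
  have h2 : (i : ℕ) + 1 < (List.ofFn δ).length := by simp; omega
  conv_lhs => rw [← List.take_append_drop i (List.ofFn δ), List.drop_eq_getElem_cons h1,
    List.drop_eq_getElem_cons h2]
  simp [lo, hi]

theorem flat_swap {n : ℕ} {i : Fin (n - 1)} {δ : Fin n → ℕ} (h : δ (lo i) = 0) :
    flat (permute (simpleSwap i) δ) = flat δ := by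
  have key : nonzeroEntries (permute (simpleSwap i) δ) = nonzeroEntries δ := by
    rw [permute_simpleSwap, nonzeroEntries, nonzeroEntries, ofFn_eq_take_append_drop i,
      ofFn_eq_take_append_drop i δ]
    have h1 : (List.ofFn (setPair i δ (δ (hi i)) (δ (lo i)))).take i = (List.ofFn δ).take i := by
      refine List.ext_getElem (by simp) fun m hm _ => ?_
      simp only [List.length_take, List.length_ofFn, lt_min_iff] at hm
      simp only [List.getElem_take, List.getElem_ofFn]
      exact setPair_of_ne i _ _ _ (by simp [lo]; omega) (by simp [hi]; omega)
    have h2 : (List.ofFn (setPair i δ (δ (hi i)) (δ (lo i)))).drop (i + 2) =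
        (List.ofFn δ).drop (i + 2) := by
      refine List.ext_getElem (by simp) fun m hm _ => ?_
      simp only [List.getElem_drop, List.getElem_ofFn]
      exact setPair_of_ne i _ _ _ (by simp [lo]; omega) (by simp [hi]; omega)
    rw [h1, h2, setPair_lo, setPair_hi, h]
    simp only [List.filter_append, List.filter_cons]
    simp
  funext p
  rw [flat, flat, key]

theorem isFlat_of_forall_adjacent {n : ℕ} {δ : Fin n → ℕ}
    (h : ∀ i : Fin (n - 1), δ (lo i) = 0 → δ (hi i) = 0) : IsFlat δ := by
  rintro ⟨p, hp⟩ ⟨q, hq⟩ hpq h0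
  have hpq : p ≤ q := hpq
  induction q, hpq using Nat.le_induction with
  | base => exact h0
  | succ q hpq' ih => exact h ⟨q, by omega⟩ (ih (by omega) hpq')

/-- Bubble sort: swapping a zero with a nonzero entry right after it keeps `flat` and lowers the
weight by 1. -/
theorem exists_permute_eq_flat_permLength_le {n : ℕ} (δ : Fin n → ℕ) :
    ∃ v : Equiv.Perm (Fin n), permute v δ = flat δ ∧
      supportWeight (flat δ) + permLength v ≤ supportWeight δ := by
  induction hN : supportWeight δ using Nat.strong_induction_on generalizing δ with
  | _ N ih =>
    by_cases h : ∀ i : Fin (n - 1), δ (lo i) = 0 → δ (hi i) = 0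
    · have h1 := flat_of_isFlat (isFlat_of_forall_adjacent h)
      refine ⟨1, by rw [permute_one, h1], ?_⟩
      have : permLength (1 : Equiv.Perm (Fin n)) ≤ 0 := permLength_le (l := []) rfl
      rw [h1]
      omega
    · push Not at h
      obtain ⟨i, h1, h2⟩ := h
      have h3 := supportWeight_swap i δ
      rw [if_neg h2, if_pos h1] at h3
      obtain ⟨v, hv, hv'⟩ := ih _ (by omega) (permute (simpleSwap i) δ) rfl
      rw [flat_swap h1] at hv hv'
      refine ⟨v * simpleSwap i, by rw [permute_mul, hv], ?_⟩
      have := permLength_mul_simpleSwap_le v i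
      omega

theorem fundamentalAtom_eq_atomSum {n : ℕ} (γ : Fin n → ℕ) : fundamentalAtom γ = atomSum γ := by
  obtain ⟨h1, h2⟩ := flattenPerm_spec γ
  obtain ⟨v, hv, hv'⟩ := exists_permute_eq_flat_permLength_le γ
  obtain ⟨h3, h4⟩ := reducedWord_spec (flattenPerm γ)⁻¹
  have h5 : permute (flattenPerm γ)⁻¹ (flat γ) = γ := by
    rw [← h1, ← permute_mul, inv_mul_cancel, permute_one]
  have h6 := h2 v hv
  have h7 := permLength_inv_le (flattenPerm γ)
  rw [fundamentalAtom, qThetaPerm, ← atomSum_of_isFlat (isFlat_flat γ), qThetaWord_atomSum, h3, h5]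
  rw [h3, h5]
  -- The length of the reduced word is at most that of `v`, which the drop in weight bounds.
  omega

/-! ### Positive sums of atoms -/

theorem isAtomPositive_fundamentalAtom {n : ℕ} (γ : Fin n → ℕ) :
    IsAtomPositive (fundamentalAtom γ) :=
  ⟨Finsupp.single γ 1, by simp⟩

theorem IsAtomPositive.sum {n : ℕ} {ι : Type*} {s : Finset ι} {f : ι → MvPolynomial (Fin n) ℂ}
    (h : ∀ j ∈ s, IsAtomPositive (f j)) : IsAtomPositive (∑ j ∈ s, f j) := by
  refine Finset.sum_induction f IsAtomPositive ?_ ⟨0, by simp⟩ h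
  rintro _ _ ⟨c, rfl⟩ ⟨d, rfl⟩
  refine ⟨c + d, ?_⟩
  rw [Finsupp.sum_add_index' (by simp) (by simp [add_smul])]

/-- The prefix sum of `η` up to the last position in `D` among the first `m` ones. -/
def blockPrefixSum {n : ℕ} (D : Finset (Fin n)) (η : Fin n → ℕ) : ℕ → ℕ
  | 0 => 0
  | m + 1 => if ∃ p ∈ D, (p : ℕ) = m then prefixSum η (m + 1) else blockPrefixSum D η m

theorem blockPrefixSum_succ_of_mem {n : ℕ} {D : Finset (Fin n)} {η : Fin n → ℕ} {p : Fin n}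
    (hp : p ∈ D) : blockPrefixSum D η (p + 1) = prefixSum η (p + 1) := by
  rw [blockPrefixSum, if_pos ⟨p, hp, rfl⟩]

theorem blockPrefixSum_succ_of_notMem {n : ℕ} {D : Finset (Fin n)} {η : Fin n → ℕ} {p : Fin n}
    (hp : p ∉ D) : blockPrefixSum D η (p + 1) = blockPrefixSum D η p := by
  rw [blockPrefixSum, if_neg]
  rintro ⟨q, hq, h⟩
  exact hp (Fin.ext h ▸ hq)

theorem blockPrefixSum_le {n : ℕ} (D : Finset (Fin n)) (η : Fin n → ℕ) (m : ℕ) :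
    blockPrefixSum D η m ≤ prefixSum η m := by
  induction m with
  | zero => simp [blockPrefixSum]
  | succ m ih =>
    rw [blockPrefixSum]
    split_ifs
    · exact le_rfl
    · exact ih.trans (prefixSum_mono η m.le_succ)

theorem blockPrefixSum_eq {n : ℕ} {D : Finset (Fin n)} {η : Fin n → ℕ} (m : ℕ) (hm : m ≤ n)
    (h : ∀ q : Fin n, (q : ℕ) < m → η q ≠ 0 → ∃ p ∈ D, q ≤ p ∧ (p : ℕ) < m) :
    blockPrefixSum D η m = prefixSum η m := by
  induction m with
  | zero => simp [blockPrefixSum]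
  | succ m ih =>
    by_cases hD : (⟨m, hm⟩ : Fin n) ∈ D
    · exact blockPrefixSum_succ_of_mem hD
    · have h0 : η ⟨m, hm⟩ = 0 := by
        by_contra h0
        obtain ⟨p, hp, h1, h2⟩ := h _ (Nat.lt_succ_self m) h0
        have : p = ⟨m, hm⟩ := le_antisymm (by rw [Fin.le_def]; simp; omega) h1
        exact hD (this ▸ hp)
      refine (blockPrefixSum_succ_of_notMem hD).trans ?_
      refine Eq.trans ?_ (prefixSum_succ η ⟨m, hm⟩).symm
      rw [h0, add_zero]
      refine ih (by omega) fun q hq hq0 => ?_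
      obtain ⟨p, hp, h1, h2⟩ := h q (by omega) hq0
      refine ⟨p, hp, h1, ?_⟩
      have : (p : ℕ) ≠ m := fun h3 => hD ((Fin.ext h3 : p = ⟨m, hm⟩) ▸ hp)
      omega

/-- If `η` is nonzero on `D` and vanishes behind `D`, then there is a weak composition with support
`D` that has the total and the prefix sums of `η` at the positions in `D`. -/
theorem exists_prefixSum_eq {n : ℕ} {D : Finset (Fin n)} {η : Fin n → ℕ} (h0 : ∀ p ∈ D, η p ≠ 0)
    (h1 : ∀ q, η q ≠ 0 → ∃ p ∈ D, q ≤ p) :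
    ∃ γ : Fin n → ℕ, (∀ p, γ p ≠ 0 ↔ p ∈ D) ∧ prefixSum γ n = prefixSum η n ∧
      ∀ p ∈ D, prefixSum γ (p + 1) = prefixSum η (p + 1) := by
  -- The increments of the step function: it jumps exactly at `D`, since `η` is positive there.
  set γ : Fin n → ℕ := fun p => blockPrefixSum D η (p + 1) - blockPrefixSum D η p with hγ
  have hlt : ∀ p ∈ D, blockPrefixSum D η p < blockPrefixSum D η (p + 1) := fun p hp => by
    have h2 := blockPrefixSum_le D η p
    have h3 := h0 p hp
    rw [blockPrefixSum_succ_of_mem hp, prefixSum_succ]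
    omega
  have hsum : ∀ m ≤ n, prefixSum γ m = blockPrefixSum D η m := by
    intro m hm
    induction m with
    | zero => simp [blockPrefixSum]
    | succ m ih =>
      refine (prefixSum_succ γ ⟨m, hm⟩).trans ?_
      have h2 : blockPrefixSum D η m ≤ blockPrefixSum D η (m + 1) := by
        by_cases hD : (⟨m, hm⟩ : Fin n) ∈ D
        · exact (hlt _ hD).le
        · exact (blockPrefixSum_succ_of_notMem hD).ge
      rw [show prefixSum γ m = _ from ih (by omega)]
      exact Nat.add_sub_cancel' h2
  refine ⟨γ, fun p => ?_, ?_, fun p hp => ?_⟩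
  · by_cases hD : p ∈ D
    · have := hlt p hD
      simp only [hγ, hD, iff_true]
      omega
    · simp [hγ, hD, blockPrefixSum_succ_of_notMem hD]
  · rw [hsum n le_rfl, blockPrefixSum_eq n le_rfl]
    intro q _ hq
    obtain ⟨p, hp, h2⟩ := h1 q hq
    exact ⟨p, hp, h2, p.2⟩
  · rw [hsum _ p.2, blockPrefixSum_succ_of_mem hp]

/-- The sum of the monomials in a class of exponents given by prefix sums on `D` is an atom. -/
theorem isAtomPositive_sum_filter {n : ℕ} {D : Finset (Fin n)} {T : Finset (Fin n → ℕ)}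
    {η : Fin n → ℕ} (hη : η ∈ T) (h0 : ∀ ε ∈ T, ∀ p ∈ D, ε p ≠ 0)
    (h1 : ∀ q, η q ≠ 0 → ∃ p ∈ D, q ≤ p)
    (hT : ∀ ε ∈ T, prefixSum ε n = prefixSum η n)
    (hT' : ∀ ε, prefixSum ε n = prefixSum η n → (∀ p ∈ D, ε p ≠ 0) →
      (∀ p ∈ D, prefixSum ε (p + 1) = prefixSum η (p + 1)) → ε ∈ T) :
    IsAtomPositive
      (∑ ε ∈ T with ∀ p ∈ D, prefixSum ε (p + 1) = prefixSum η (p + 1), xPow ε) := by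
  obtain ⟨γ, hγD, hγn, hγ⟩ := exists_prefixSum_eq (h0 η hη) h1
  have : (T.filter fun ε => ∀ p ∈ D, prefixSum ε (p + 1) = prefixSum η (p + 1)) =
      atomExponents γ := by
    ext ε
    rw [Finset.mem_filter, mem_atomExponents, hγn]
    simp only [hγD]
    constructor
    · rintro ⟨hε, h⟩
      exact ⟨hT ε hε, fun p hp => ⟨h0 ε hε p hp, by rw [h p hp, hγ p hp]⟩⟩
    · rintro ⟨h2, h3⟩
      have h4 : ∀ p ∈ D, prefixSum ε (p + 1) = prefixSum η (p + 1) := fun p hp => by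
        rw [(h3 p hp).2, hγ p hp]
      exact ⟨hT' ε h2 (fun p hp => (h3 p hp).1) h4, h4⟩
  rw [this]
  have h := isAtomPositive_fundamentalAtom γ
  rwa [fundamentalAtom_eq_atomSum] at h

/-- The last hypothesis makes `T` a union of full classes of equal prefix sums on `D`; each class
sums to one atom. -/
theorem isAtomPositive_sum {n : ℕ} (D : Finset (Fin n)) (T : Finset (Fin n → ℕ))
    (h0 : ∀ ε ∈ T, ∀ p ∈ D, ε p ≠ 0) (h1 : ∀ ε ∈ T, ∀ q, ε q ≠ 0 → ∃ p ∈ D, q ≤ p)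
    (hT : ∀ η ∈ T, ∀ ε ∈ T, prefixSum ε n = prefixSum η n)
    (hT' : ∀ η ∈ T, ∀ ε, prefixSum ε n = prefixSum η n → (∀ p ∈ D, ε p ≠ 0) →
      (∀ p ∈ D, prefixSum ε (p + 1) = prefixSum η (p + 1)) → ε ∈ T) :
    IsAtomPositive (∑ ε ∈ T, xPow ε) := by
  set g : (Fin n → ℕ) → D → ℕ := fun ε p => prefixSum ε (p + 1) with hg
  rw [← Finset.sum_fiberwise_of_maps_to (fun ε hε => Finset.mem_image_of_mem g hε)]
  refine IsAtomPositive.sum fun y hy => ?_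
  obtain ⟨η, hη, rfl⟩ := Finset.mem_image.1 hy
  have := isAtomPositive_sum_filter hη h0 (h1 η hη) (hT η hη) (hT' η hη)
  convert this using 3 with ε
  simp [hg, funext_iff]

/-! ### The product with the atom of a padded strong composition -/

theorem isFlat_padZeros {k n : ℕ} {α : Fin k → ℕ} (hα : ∀ i, 0 < α i) :
    IsFlat (padZeros n α) := by
  intro p q hpq hp
  have : ¬ (p : ℕ) < k := fun h => by
    rw [padZeros, dif_pos h] at hp
    exact (hα _).ne' hp
  rw [padZeros, dif_neg fun h => this (lt_of_le_of_lt hpq h)]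

end FundAtom

open FundAtom in
theorem mainTheorem7 {k n : ℕ} (hkn : k ≤ n) (α : Fin k → ℕ) (hα : ∀ i, 0 < α i)
    (β : Fin n → ℕ) :
    FundAtom.IsAtomPositive
      (FundAtom.fundamentalAtom (FundAtom.padZeros n α) * FundAtom.fundamentalAtom β) := by
  set a := padZeros n α with ha
  have ha0 : ∀ p : Fin n, a p ≠ 0 ↔ (p : ℕ) < k := fun p => by
    rw [ha, padZeros]
    split_ifs with h
    · simp [h, (hα _).ne']
    · simp [h]
  rw [fundamentalAtom_eq_atomSum, fundamentalAtom_eq_atomSum,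
    atomSum_of_isFlat (isFlat_padZeros hα), atomSum, Finset.mul_sum]
  have himage : ∑ ε ∈ atomExponents β, xPow a * xPow ε =
      ∑ η ∈ (atomExponents β).image (a + ·), xPow η := by
    rw [Finset.sum_image fun x _ y _ h => add_left_cancel h]
    exact Finset.sum_congr rfl fun ε _ => (xPow_add a ε).symm
  rw [himage]
  refine isAtomPositive_sum (Finset.univ.filter fun p : Fin n => (p : ℕ) < k ∨ β p ≠ 0) _
    ?_ ?_ ?_ ?_
  · intro η hη p hp
    obtain ⟨ε, hε, rfl⟩ := Finset.mem_image.1 hη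
    rw [Pi.add_apply]
    rcases (Finset.mem_filter.1 hp).2 with h | h
    · have := (ha0 p).2 h
      omega
    · have := ((mem_atomExponents.1 hε).2 p h).1
      omega
  · intro η hη q hq
    obtain ⟨ε, hε, rfl⟩ := Finset.mem_image.1 hη
    by_cases h : ε q = 0
    · exact ⟨q, by simpa using Or.inl ((ha0 q).1 (by simpa [h] using hq)), le_rfl⟩
    · obtain ⟨p, hp, hp'⟩ := exists_le_of_mem_atomExponents hε h
      exact ⟨p, by simpa using Or.inr hp', hp⟩
  · intro η hη η' hη'
    obtain ⟨ε, hε, rfl⟩ := Finset.mem_image.1 hη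
    obtain ⟨ε', hε', rfl⟩ := Finset.mem_image.1 hη'
    rw [prefixSum_add, prefixSum_add, (mem_atomExponents.1 hε).1, (mem_atomExponents.1 hε').1]
  · intro η hη ζ h1 h2 h3
    obtain ⟨ε, hε, rfl⟩ := Finset.mem_image.1 hη
    -- All of the first `k` positions lie in `D`, so `ζ` and `a + ε` agree there entry by entry.
    have h4 : ∀ m ≤ k, prefixSum ζ m = prefixSum (a + ε) m := by
      intro m hm
      cases m with
      | zero => simp
      | succ m => exact h3 ⟨m, by omega⟩ (by simpa using Or.inl hm)
    have h5 : ∀ p : Fin n, (p : ℕ) < k → ζ p = a p + ε p := fun p hp => by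
      have h6 := prefixSum_succ ζ p
      rw [h4 _ hp, h4 _ hp.le, prefixSum_succ, Pi.add_apply] at h6
      omega
    -- The truncated subtraction is exact: `ζ` dominates `a` below `k`, and `a` is zero from `k` on.
    have h6 : a + (ζ - a) = ζ := by
      funext p
      simp only [Pi.add_apply, Pi.sub_apply]
      by_cases hp : (p : ℕ) < k
      · have := h5 p hp
        omega
      · have := not_not.1 (mt (ha0 p).1 hp)
        omega
    refine Finset.mem_image.2 ⟨ζ - a, ?_, h6⟩
    have h7 := fun m => prefixSum_add a (ζ - a) m
    rw [h6] at h7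
    rw [mem_atomExponents] at hε ⊢
    refine ⟨?_, fun p hp => ?_⟩
    · rw [h7, prefixSum_add] at h1
      omega
    · have hpD : p ∈ Finset.univ.filter fun p : Fin n => (p : ℕ) < k ∨ β p ≠ 0 := by
        simpa using Or.inr hp
      have h8 := h3 p hpD
      rw [h7, prefixSum_add] at h8
      have h9 := hε.2 p hp
      refine ⟨?_, by omega⟩
      -- Below `k` the difference equals `ε p`, nonzero on the support of `β`; from `k` on it equals
      -- `ζ p`, nonzero on `D`.
      rw [Pi.sub_apply]
      by_cases hpk : (p : ℕ) < k
      · have := h5 p hpk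
        omega
      · have := not_not.1 (mt (ha0 p).1 hpk)
        have := h2 p hpD
        omega
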